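/- For $x$ in the closed unit disk $\overline{\mathbb D}=\{x\in\mathbb C : |x|\le 1\}$ let $\mathrm{Li}_2(x)=\sum_{n=1}^\infty \frac{x^n}{n^2}$ be the dilogarithm and, for every integer $k\ge 1$, put $$f_k(x)=\frac1k\,\Re\sqrt{\mathrm{Li}_2(x^k)},$$ where $\sqrt{\cdot}$ is the principal branch of the square root (so $\Re\sqrt{\cdot}\ge 0$). Define $$\mathcal R(1)=\{x\in\overline{\mathbb D}: f_1(x)\ge f_2(x),\ f_1(x)\ge f_3(x)\},$$ $$\mathcal R(2)=\{x\in\overline{\mathbb D}: f_2(x)\ge f_1(x),\ f_2(x)\ge f_3(x)\},$$ $$\mathcal R(3)=\{x\in\overline{\mathbb D}: f_3(x)\ge f_1(x),\ f_3(x)\ge f_2(x)\}.$$ Then: (a) $f_k(x)\le \max[f_1(x),f_2(x),f_3(x)]$ for all $x\in\overline{\mathbb D}$ and all $k\ge 4$. (b) For $x\in\mathcal R(1)$, $f_1(x)\ge f_k(x)$ for all $k\ge 2$. (c) For $x\in\mathcal R(2)$, $f_2(x)\ge f_k(x)$ for all $k\ge 3$ and for $k=1$. (d) For $x\in\mathcal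 R(3)$, $f_3(x)\ge f_k(x)$ for all $k\ge 4$ and for $k=1,2$. -/

import Mathlib

/-- The dilogarithm `Li₂(x) = ∑_{n ≥ 1} xⁿ / n²`; the series converges absolutely for `‖x‖ ≤ 1`. -/
noncomputable def dilog (x : ℂ) : ℂ :=
  ∑' n : ℕ, x ^ (n + 1) / ((n : ℂ) + 1) ^ 2

/-- `f_k(x) = (1/k) Re √(Li₂(x^k))`, with the principal square root. -/
noncomputable def dilogF (k : ℕ) (x : ℂ) : ℝ :=
  (1 / (k : ℝ)) * (Complex.sqrt (dilog (x ^ k))).re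

/-- The closed unit disk. -/
def unitDisk : Set ℂ := Metric.closedBall 0 1

/-- The region of the unit disk where `f_1 ≥ f_2` and `f_1 ≥ f_3`. -/
def regionOne : Set ℂ :=
  {x | x ∈ unitDisk ∧ dilogF 2 x ≤ dilogF 1 x ∧ dilogF 3 x ≤ dilogF 1 x}

/-- The region of the unit disk where `f_2 ≥ f_1` and `f_2 ≥ f_3`. -/
def regionTwo : Set ℂ :=
  {x | x ∈ unitDisk ∧ dilogF 1 x ≤ dilogF 2 x ∧ dilogF 3 x ≤ dilogF 2 x}

/-- The region of the unit disk where `f_3 ≥ f_1` and `f_3 ≥ f_2`. -/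
def regionThree : Set ℂ :=
  {x | x ∈ unitDisk ∧ dilogF 1 x ≤ dilogF 3 x ∧ dilogF 2 x ≤ dilogF 3 x}

/-!
Since `(Re √z)² = (‖z‖ + Re z) / 2`, everything is a matter of bounding `‖Li₂‖ + Re Li₂`.
From above, `‖Li₂ z‖ ≤ ζ(2) ‖z‖`. From below, write `Li₂ x = ∫₀¹ x / (1 - x t) · (-log t) dt` and
take the component of the kernel in the direction `‖x‖ + x` bisecting `x` and the positive axis:
it is at least `(1 - t) / (1 + t)²` times its value at `t = 0`, with equality at `x = -1`, whence
`(Re √Li₂ x)² ≥ c (Re √x)²` for `c = ∫₀¹ (1 - t) / (1 + t)² · (-log t) dt = 2 log 2 - π² / 12`.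

As `c ≥ 9 / 16`, this yields `f₁² ≥ 9 / 32 (‖x‖ + Re x)` and `f₂² ≥ 9 / 64 (Re x)²`, one of which
is large: `f₁` away from the negative axis, `f₂` near it. For `k ≥ 5` the bound
`f_k² ≤ ζ(2) ‖x‖² / k²` is then enough. For `k = 4` one gains a factor `2` when `Re x⁴ ≤ 0`, because
then `Re Li₂(x⁴) ≤ 0`; otherwise `arg x` stays away from `± 3π / 4`, near which both lower bounds
are weakest.
-/

open MeasureTheory Set
open scoped ComplexConjugate Real

section PrincipalSquareRoot

theorem neg_norm_le_re (z : ℂ) : -‖z‖ ≤ z.re :=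
  neg_le_of_abs_le (Complex.abs_re_le_norm z)

theorem re_sqrt_nonneg (z : ℂ) : 0 ≤ (Complex.sqrt z).re := by
  rw [Complex.sqrt, Complex.cpow_inv_two_re]
  exact Real.sqrt_nonneg _

theorem re_sqrt_sq (z : ℂ) : (Complex.sqrt z).re ^ 2 = (‖z‖ + z.re) / 2 := by
  rw [Complex.sqrt, Complex.cpow_inv_two_re, Real.sq_sqrt]
  linarith [neg_norm_le_re z]

theorem re_sqrt_sq_le_norm (z : ℂ) : (Complex.sqrt z).re ^ 2 ≤ ‖z‖ := by
  linarith [re_sqrt_sq z, Complex.re_le_norm z]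

theorem re_sqrt_sq_le_half_norm {z : ℂ} (hz : z.re ≤ 0) : (Complex.sqrt z).re ^ 2 ≤ ‖z‖ / 2 := by
  linarith [re_sqrt_sq z]

theorem re_sqrt_pow_two_sq (z : ℂ) : (Complex.sqrt (z ^ 2)).re ^ 2 = z.re ^ 2 := by
  rw [re_sqrt_sq, norm_pow, Complex.sq_norm, Complex.normSq_apply, sq z, Complex.mul_re]
  ring

theorem re_conj_add_norm_mul_le (x w : ℂ) :
    ((conj x + ‖x‖) * w).re ≤ ‖x‖ * (‖w‖ + w.re) := by
  have h := Complex.re_le_norm (conj x * w)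
  rw [norm_mul, Complex.norm_conj] at h
  rw [add_mul, Complex.add_re, Complex.re_ofReal_mul]
  linarith

end PrincipalSquareRoot

section Series

variable {x : ℂ}

theorem norm_pow_le_one (hx : ‖x‖ ≤ 1) (k : ℕ) : ‖x ^ k‖ ≤ 1 :=
  norm_pow x k ▸ pow_le_one₀ (norm_nonneg x) hx

theorem hasSum_one_div_succ_sq :
    HasSum (fun n : ℕ => 1 / ((n : ℝ) + 1) ^ 2) (π ^ 2 / 6) := by
  simpa using (hasSum_nat_add_iff' 1).2 hasSum_zeta_two

theorem norm_dilog_term (x : ℂ) (n : ℕ) :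
    ‖x ^ (n + 1) / ((n : ℂ) + 1) ^ 2‖ = ‖x‖ ^ (n + 1) / ((n : ℝ) + 1) ^ 2 := by
  rw [norm_div, norm_pow, norm_pow, ← Nat.cast_add_one, Complex.norm_natCast, Nat.cast_add_one]

theorem norm_dilog_term_le (hx : ‖x‖ ≤ 1) (n : ℕ) :
    ‖x ^ (n + 1) / ((n : ℂ) + 1) ^ 2‖ ≤ 1 / ((n : ℝ) + 1) ^ 2 * ‖x‖ := by
  rw [norm_dilog_term, one_div_mul_eq_div]
  gcongr
  exact pow_le_of_le_one (norm_nonneg x) hx n.succ_ne_zero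

theorem hasSum_dilog (hx : ‖x‖ ≤ 1) :
    HasSum (fun n : ℕ => x ^ (n + 1) / ((n : ℂ) + 1) ^ 2) (dilog x) :=
  ((hasSum_one_div_succ_sq.mul_right ‖x‖).summable.of_norm_bounded (norm_dilog_term_le hx)).hasSum

theorem norm_dilog_le (hx : ‖x‖ ≤ 1) : ‖dilog x‖ ≤ π ^ 2 / 6 * ‖x‖ :=
  tsum_of_norm_bounded (hasSum_one_div_succ_sq.mul_right ‖x‖) (norm_dilog_term_le hx)

theorem dilog_add_dilog_neg (hx : ‖x‖ ≤ 1) : dilog x + dilog (-x) = dilog (x ^ 2) / 2 := by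
  have hsum := (hasSum_dilog hx).add (hasSum_dilog (x := -x) (by rwa [norm_neg]))
  refine hsum.unique (zero_add (dilog (x ^ 2) / 2) ▸ HasSum.even_add_odd ?_ ?_)
  · convert! hasSum_zero (α := ℂ) (β := ℕ) using 2 with n
    rw [Odd.neg_pow ⟨n, rfl⟩]
    ring
  · refine ((hasSum_dilog (norm_pow_le_one hx 2)).div_const 2).congr_fun fun n => ?_
    rw [Even.neg_pow ⟨n + 1, by ring⟩]
    have hn : (n : ℂ) + 1 ≠ 0 := n.cast_add_one_ne_zero
    have hden : ((2 * n + 1 : ℕ) : ℂ) + 1 = 2 * (n + 1) := by push_cast; ring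
    rw [hden, ← pow_mul]
    field_simp
    ring

theorem dilog_one : dilog 1 = (π ^ 2 / 6 : ℝ) := by
  refine (hasSum_dilog (by simp)).unique ?_
  simpa using Complex.hasSum_ofReal.2 hasSum_one_div_succ_sq

theorem dilog_neg_one : dilog (-1) = (-(π ^ 2 / 12) : ℝ) := by
  have h := dilog_add_dilog_neg (x := 1) (by simp)
  rw [one_pow, dilog_one] at h
  push_cast at h ⊢
  linear_combination h

end Series

section LogarithmicWeight

theorem neg_log_nonneg {t : ℝ} (ht : t ∈ Ioo (0 : ℝ) 1) : 0 ≤ -Real.log t :=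
  neg_nonneg.2 (Real.log_nonpos ht.1.le ht.2.le)

theorem intervalIntegrable_mul_neg_log {g : ℝ → ℝ} (hg : ContinuousOn g (Icc 0 1)) :
    IntervalIntegrable (fun t => g t * -Real.log t) volume 0 1 :=
  intervalIntegral.intervalIntegrable_log'.neg.continuousOn_mul (by rwa [uIcc_of_le zero_le_one])

theorem integrableOn_mul_neg_log {g : ℝ → ℝ} (hg : ContinuousOn g (Icc 0 1)) :
    IntegrableOn (fun t => g t * -Real.log t) (Ioo 0 1) :=
  (intervalIntegrable_iff_integrableOn_Ioo_of_le zero_le_one).1 (intervalIntegrable_mul_neg_log hg)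

theorem integral_mul_neg_log_eq_sub {g G : ℝ → ℝ} (hg : ContinuousOn g (Icc 0 1))
    (hG : ContinuousOn G (Icc 0 1))
    (hderiv : ∀ t ∈ Ioo (0 : ℝ) 1, HasDerivAt G (g t * -Real.log t) t) :
    ∫ t in Ioo (0 : ℝ) 1, g t * -Real.log t = G 1 - G 0 := by
  rw [← integral_Ioc_eq_integral_Ioo, ← intervalIntegral.integral_of_le zero_le_one]
  exact intervalIntegral.integral_eq_sub_of_hasDerivAt_of_le zero_le_one hG hderiv
    (intervalIntegrable_mul_neg_log hg)

theorem integral_pow_mul_neg_log (n : ℕ) :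
    ∫ t in Ioo (0 : ℝ) 1, t ^ n * -Real.log t = 1 / ((n : ℝ) + 1) ^ 2 := by
  have := Real.continuous_mul_log
  rw [integral_mul_neg_log_eq_sub (by fun_prop)
    (G := fun t => t ^ (n + 1) / ((n : ℝ) + 1) ^ 2 - t ^ n * (t * Real.log t) / ((n : ℝ) + 1))
    (by fun_prop) fun t ht => ?_]
  · simp
  · have hlog := Real.hasDerivAt_mul_log ht.1.ne'
    refine (((hasDerivAt_pow (n + 1) t).div_const _).sub
      (((hasDerivAt_pow n t).mul hlog).div_const _)).congr_deriv ?_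
    have : (n : ℝ) + 1 ≠ 0 := n.cast_add_one_ne_zero
    rcases n with _ | n
    · simp
    · push_cast at *
      field_simp
      ring

theorem one_add_ne_zero {t : ℝ} (ht : t ∈ Icc (0 : ℝ) 1) : 1 + t ≠ 0 :=
  (add_pos_of_pos_of_nonneg one_pos ht.1).ne'

theorem continuousOn_inv_one_add_sq :
    ContinuousOn (fun t : ℝ => ((1 + t) ^ 2)⁻¹) (Icc 0 1) :=
  ContinuousOn.inv₀ (by fun_prop) fun _ ht => pow_ne_zero 2 (one_add_ne_zero ht)

theorem continuousOn_log_one_add_sub :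
    ContinuousOn (fun t : ℝ => Real.log (1 + t) - t * Real.log t / (1 + t)) (Icc 0 1) :=
  (ContinuousOn.log (by fun_prop) fun _ ht => one_add_ne_zero ht).sub
    (Real.continuous_mul_log.continuousOn.div (by fun_prop) fun _ ht => one_add_ne_zero ht)

theorem integral_inv_one_add_sq_mul_neg_log :
    ∫ t in Ioo (0 : ℝ) 1, ((1 + t) ^ 2)⁻¹ * -Real.log t = Real.log 2 := by
  rw [integral_mul_neg_log_eq_sub continuousOn_inv_one_add_sq continuousOn_log_one_add_sub
    fun t ht => ?_]
  · norm_num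
  · have h1t := one_add_ne_zero (Ioo_subset_Icc_self ht)
    have hone := (hasDerivAt_id t).const_add 1
    refine ((hone.log h1t).sub
      ((Real.hasDerivAt_mul_log ht.1.ne').div hone h1t)).congr_deriv ?_
    simp only [id_eq]
    field_simp
    ring

end LogarithmicWeight

section IntegralRepresentation

variable {x : ℂ} {t : ℝ}

theorem norm_mul_ofReal_le (hx : ‖x‖ ≤ 1) (ht : 0 ≤ t) : ‖x * t‖ ≤ t := by
  rw [norm_mul, Complex.norm_real, Real.norm_of_nonneg ht]
  exact mul_le_of_le_one_left ht hx

theorem one_sub_le_norm_one_sub_mul (hx : ‖x‖ ≤ 1) (ht : 0 ≤ t) : 1 - t ≤ ‖1 - x * t‖ := by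
  have h := norm_sub_norm_le (1 : ℂ) (x * t)
  rw [norm_one] at h
  linarith [norm_mul_ofReal_le hx ht]

theorem neg_log_le_one_sub_mul (ht : 0 < t) : -Real.log t ≤ (1 - t) * (1 - Real.log t) := by
  have h := mul_le_mul_of_nonneg_left (Real.one_sub_inv_le_log_of_pos ht) ht.le
  rw [mul_sub, mul_one, mul_inv_cancel₀ ht.ne'] at h
  linarith

theorem integrableOn_dilog_kernel (hx : ‖x‖ ≤ 1) :
    IntegrableOn (fun t : ℝ => x / (1 - x * t) * (-Real.log t : ℝ)) (Ioo 0 1) := by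
  have hdom : IntegrableOn (fun t : ℝ => 1 - Real.log t) (Ioo 0 1) :=
    (intervalIntegrable_iff_integrableOn_Ioo_of_le zero_le_one).1
      (intervalIntegrable_const.sub intervalIntegral.intervalIntegrable_log')
  refine Integrable.mono' hdom (Measurable.aestronglyMeasurable (by fun_prop)) ?_
  filter_upwards [ae_restrict_mem measurableSet_Ioo] with t ht
  have h1t : 0 < 1 - t := sub_pos.2 ht.2
  rw [norm_mul, norm_div, Complex.norm_real, Real.norm_of_nonneg (neg_log_nonneg ht)]
  calc ‖x‖ / ‖1 - x * t‖ * -Real.log t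
      ≤ 1 / (1 - t) * ((1 - t) * (1 - Real.log t)) := by
        gcongr
        · exact neg_log_nonneg ht
        · exact one_sub_le_norm_one_sub_mul hx ht.1.le
        · exact neg_log_le_one_sub_mul ht.1
    _ = 1 - Real.log t := by field_simp

theorem tsum_pow_succ_mul_pow {z w : ℂ} (h : ‖z * w‖ < 1) :
    ∑' n : ℕ, z ^ (n + 1) * w ^ n = z / (1 - z * w) := by
  simp_rw [pow_succ', mul_assoc, ← mul_pow]
  rw [tsum_mul_left, tsum_geometric_of_norm_lt_one h, div_eq_mul_inv]

theorem dilog_eq_integral (hx : ‖x‖ ≤ 1) :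
    dilog x = ∫ t in Ioo (0 : ℝ) 1, x / (1 - x * t) * (-Real.log t : ℝ) := by
  let F (n : ℕ) (t : ℝ) : ℂ := x ^ (n + 1) * (t ^ n * -Real.log t : ℝ)
  have hF (n : ℕ) : IntegrableOn (F n) (Ioo 0 1) :=
    (integrableOn_mul_neg_log (by fun_prop)).ofReal.const_mul _
  have hF_integral (n : ℕ) :
      ∫ t in Ioo (0 : ℝ) 1, F n t = x ^ (n + 1) / ((n : ℂ) + 1) ^ 2 := by
    simp only [F]
    rw [integral_const_mul, integral_complex_ofReal, integral_pow_mul_neg_log]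
    push_cast
    ring
  have hF_norm (n : ℕ) :
      ∫ t in Ioo (0 : ℝ) 1, ‖F n t‖ = ‖x ^ (n + 1) / ((n : ℂ) + 1) ^ 2‖ := by
    rw [norm_dilog_term, ← mul_one_div, ← integral_pow_mul_neg_log, ← integral_const_mul]
    refine setIntegral_congr_fun measurableSet_Ioo fun t ht => ?_
    simp only [F]
    rw [norm_mul, norm_pow, Complex.norm_real,
      Real.norm_of_nonneg (mul_nonneg (pow_nonneg ht.1.le n) (neg_log_nonneg ht))]
  have hF_tsum {t : ℝ} (ht : t ∈ Ioo (0 : ℝ) 1) :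
      ∑' n, F n t = x / (1 - x * t) * (-Real.log t : ℝ) := by
    rw [← tsum_pow_succ_mul_pow ((norm_mul_ofReal_le hx ht.1.le).trans_lt ht.2), ← tsum_mul_right]
    exact tsum_congr fun n => by simp only [F]; push_cast; ring
  have h := hasSum_integral_of_summable_integral_norm hF
    (by simpa only [hF_norm] using (hasSum_dilog hx).summable.norm)
  simp only [hF_integral] at h
  rw [(hasSum_dilog hx).unique h]
  exact setIntegral_congr_fun measurableSet_Ioo fun t ht => hF_tsum ht

theorem re_mul_dilog_kernel (c : ℂ) (x : ℂ) (t : ℝ) :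
    (c * (x / (1 - x * t) * (-Real.log t : ℝ))).re = (c * (x / (1 - x * t))).re * -Real.log t := by
  rw [← mul_assoc, Complex.re_mul_ofReal]

theorem integrableOn_re_dilog_kernel (hx : ‖x‖ ≤ 1) (c : ℂ) :
    IntegrableOn (fun t : ℝ => (c * (x / (1 - x * t))).re * -Real.log t) (Ioo 0 1) := by
  simpa only [IntegrableOn, RCLike.re_to_complex, re_mul_dilog_kernel] using
    ((integrableOn_dilog_kernel hx).const_mul c).re

theorem re_mul_dilog_eq_integral (hx : ‖x‖ ≤ 1) (c : ℂ) :
    (c * dilog x).re = ∫ t in Ioo (0 : ℝ) 1, (c * (x / (1 - x * t))).re * -Real.log t := by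
  simp_rw [← re_mul_dilog_kernel]
  rw [dilog_eq_integral hx, ← integral_const_mul]
  exact (integral_re ((integrableOn_dilog_kernel hx).const_mul c)).symm

end IntegralRepresentation

section KernelBounds

variable {x : ℂ} {t : ℝ}

theorem re_mul_div_one_sub_mul (c : ℂ) (x : ℂ) (t : ℝ) :
    (c * (x / (1 - x * t))).re = (c * (x - t * ‖x‖ ^ 2)).re / ‖1 - x * t‖ ^ 2 := by
  have hnum : x * conj (1 - x * t) = x - t * ‖x‖ ^ 2 := by
    rw [map_sub, map_one, map_mul, Complex.conj_ofReal, ← Complex.conj_mul']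
    ring
  rw [div_eq_mul_inv, Complex.inv_def, ← mul_assoc x, hnum, ← mul_assoc, Complex.re_mul_ofReal,
    Complex.normSq_eq_norm_sq, div_eq_mul_inv]

theorem re_dilog_nonpos (hx : ‖x‖ ≤ 1) (hre : x.re ≤ 0) : (dilog x).re ≤ 0 := by
  rw [← one_mul (dilog x), re_mul_dilog_eq_integral hx]
  refine setIntegral_nonpos measurableSet_Ioo fun t ht =>
    mul_nonpos_of_nonpos_of_nonneg ?_ (neg_log_nonneg ht)
  rw [re_mul_div_one_sub_mul]
  refine div_nonpos_of_nonpos_of_nonneg ?_ (sq_nonneg _)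
  have : 0 ≤ t * ‖x‖ ^ 2 := mul_nonneg ht.1.le (sq_nonneg _)
  rw [one_mul]
  norm_cast
  simp only [Complex.sub_re, Complex.ofReal_re]
  linarith

theorem re_conj_add_norm_mul_kernel (x : ℂ) (t : ℝ) :
    ((conj x + ‖x‖) * (x / (1 - x * t))).re =
      ‖x‖ * (‖x‖ + x.re) * ((1 - t * ‖x‖) / ‖1 - x * t‖ ^ 2) := by
  have hnum : ((conj x + ‖x‖) * (x - t * ‖x‖ ^ 2)).re = ‖x‖ * (‖x‖ + x.re) * (1 - t * ‖x‖) := by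
    have hexpand : (conj x + ‖x‖) * (x - t * ‖x‖ ^ 2) =
        ((‖x‖ ^ 2 - t * ‖x‖ ^ 3 : ℝ) : ℂ) + (‖x‖ : ℝ) * x - (t * ‖x‖ ^ 2 : ℝ) * conj x := by
      push_cast
      linear_combination Complex.conj_mul' x
    rw [hexpand, Complex.sub_re, Complex.add_re, Complex.re_ofReal_mul, Complex.re_ofReal_mul,
      Complex.ofReal_re, Complex.conj_re]
    ring
  rw [re_mul_div_one_sub_mul, hnum, mul_div_assoc]

theorem one_sub_div_one_add_sq_le_kernel (hx : ‖x‖ ≤ 1) (ht : t ∈ Ioo (0 : ℝ) 1) :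
    (1 - t) / (1 + t) ^ 2 ≤ (1 - t * ‖x‖) / ‖1 - x * t‖ ^ 2 := by
  have h1t : 0 < 1 - t := sub_pos.2 ht.2
  have hpos : 0 < ‖1 - x * t‖ := h1t.trans_le (one_sub_le_norm_one_sub_mul hx ht.1.le)
  have hnum : t * ‖x‖ ≤ t := mul_le_of_le_one_right ht.1.le hx
  have hden : ‖1 - x * t‖ ≤ 1 + t := by
    refine (norm_sub_le _ _).trans ?_
    rw [norm_one]
    gcongr
    exact norm_mul_ofReal_le hx ht.1.le
  gcongr
  linarith

theorem continuousOn_one_sub_div_one_add_sq :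
    ContinuousOn (fun t : ℝ => (1 - t) / (1 + t) ^ 2) (Icc 0 1) :=
  ContinuousOn.div (by fun_prop) (by fun_prop) fun _ ht =>
    pow_ne_zero 2 (one_add_ne_zero ht)

theorem integral_inv_one_add_mul_neg_log :
    ∫ t in Ioo (0 : ℝ) 1, (1 + t)⁻¹ * -Real.log t = π ^ 2 / 12 := by
  have h := re_mul_dilog_eq_integral (x := -1) (by simp) (-1)
  rw [dilog_neg_one, Complex.re_mul_ofReal] at h
  simp only [Complex.neg_re, Complex.one_re, neg_mul_neg, one_mul] at h
  rw [h]
  refine setIntegral_congr_fun measurableSet_Ioo fun t _ => ?_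
  have : -1 * (-1 / (1 - -1 * (t : ℂ))) = ((1 + t)⁻¹ : ℝ) := by
    push_cast
    ring
  simp only [this, Complex.ofReal_re]

theorem integral_one_sub_div_one_add_sq_mul_neg_log :
    ∫ t in Ioo (0 : ℝ) 1, (1 - t) / (1 + t) ^ 2 * -Real.log t = 2 * Real.log 2 - π ^ 2 / 12 := by
  have hsq : IntegrableOn (fun t : ℝ => ((1 + t) ^ 2)⁻¹ * -Real.log t) (Ioo 0 1) :=
    integrableOn_mul_neg_log continuousOn_inv_one_add_sq
  have hinv : IntegrableOn (fun t : ℝ => (1 + t)⁻¹ * -Real.log t) (Ioo 0 1) :=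
    integrableOn_mul_neg_log (ContinuousOn.inv₀ (by fun_prop) fun _ ht => one_add_ne_zero ht)
  rw [← integral_inv_one_add_sq_mul_neg_log, ← integral_inv_one_add_mul_neg_log,
    ← integral_const_mul, ← integral_sub (hsq.const_mul 2) hinv]
  refine setIntegral_congr_fun measurableSet_Ioo fun t ht => ?_
  have h1t := one_add_ne_zero (Ioo_subset_Icc_self ht)
  field_simp
  ring

theorem mul_norm_add_re_le_norm_dilog_add_re (hx : ‖x‖ ≤ 1) :
    (2 * Real.log 2 - π ^ 2 / 12) * (‖x‖ + x.re) ≤ ‖dilog x‖ + (dilog x).re := by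
  rcases eq_or_ne x 0 with rfl | hx0
  · rw [norm_zero, Complex.zero_re, add_zero, mul_zero]
    linarith [neg_norm_le_re (dilog 0)]
  have hr : 0 < ‖x‖ := norm_pos_iff.2 hx0
  have hcoef : 0 ≤ ‖x‖ * (‖x‖ + x.re) := mul_nonneg hr.le (by linarith [neg_norm_le_re x])
  refine le_of_mul_le_mul_left ?_ hr
  calc ‖x‖ * ((2 * Real.log 2 - π ^ 2 / 12) * (‖x‖ + x.re))
      = ∫ t in Ioo (0 : ℝ) 1,
          ‖x‖ * (‖x‖ + x.re) * ((1 - t) / (1 + t) ^ 2 * -Real.log t) := by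
        rw [integral_const_mul, integral_one_sub_div_one_add_sq_mul_neg_log]
        ring
    _ ≤ ∫ t in Ioo (0 : ℝ) 1, ((conj x + ‖x‖) * (x / (1 - x * t))).re * -Real.log t := by
        refine setIntegral_mono_on
          ((integrableOn_mul_neg_log continuousOn_one_sub_div_one_add_sq).const_mul _)
          (integrableOn_re_dilog_kernel hx _) measurableSet_Ioo fun t ht => ?_
        rw [re_conj_add_norm_mul_kernel, ← mul_assoc]
        exact mul_le_mul_of_nonneg_right
          (mul_le_mul_of_nonneg_left (one_sub_div_one_add_sq_le_kernel hx ht) hcoef)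
          (neg_log_nonneg ht)
    _ = ((conj x + ‖x‖) * dilog x).re := (re_mul_dilog_eq_integral hx _).symm
    _ ≤ ‖x‖ * (‖dilog x‖ + (dilog x).re) := re_conj_add_norm_mul_le x (dilog x)

theorem mul_re_sqrt_sq_le_re_sqrt_dilog_sq (hx : ‖x‖ ≤ 1) :
    (2 * Real.log 2 - π ^ 2 / 12) * (Complex.sqrt x).re ^ 2 ≤ (Complex.sqrt (dilog x)).re ^ 2 := by
  rw [re_sqrt_sq, re_sqrt_sq]
  linarith [mul_norm_add_re_le_norm_dilog_add_re hx]

end KernelBounds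

section NormalizedRoots

variable {x : ℂ} {k : ℕ}

theorem dilogF_nonneg (k : ℕ) (x : ℂ) : 0 ≤ dilogF k x :=
  mul_nonneg (by positivity) (re_sqrt_nonneg _)

theorem dilogF_sq (k : ℕ) (x : ℂ) :
    dilogF k x ^ 2 = (Complex.sqrt (dilog (x ^ k))).re ^ 2 / (k : ℝ) ^ 2 := by
  rw [dilogF, one_div_mul_eq_div, div_pow]

theorem nine_sixteenths_le_two_mul_log_two_sub : 9 / 16 ≤ 2 * Real.log 2 - π ^ 2 / 12 := by
  have hpi : π ^ 2 ≤ 3.1416 ^ 2 := pow_le_pow_left₀ Real.pi_nonneg Real.pi_lt_d4.le 2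
  linarith [Real.log_two_gt_d9]

theorem le_dilogF_sq (hx : ‖x‖ ≤ 1) (k : ℕ) :
    9 / 16 * (Complex.sqrt (x ^ k)).re ^ 2 / (k : ℝ) ^ 2 ≤ dilogF k x ^ 2 := by
  rw [dilogF_sq]
  gcongr
  exact (mul_le_mul_of_nonneg_right nine_sixteenths_le_two_mul_log_two_sub (sq_nonneg _)).trans
    (mul_re_sqrt_sq_le_re_sqrt_dilog_sq (norm_pow_le_one hx k))

theorem le_dilogF_one_sq (hx : ‖x‖ ≤ 1) : 9 / 32 * (‖x‖ + x.re) ≤ dilogF 1 x ^ 2 := by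
  have h := le_dilogF_sq hx 1
  rw [pow_one, re_sqrt_sq, Nat.cast_one] at h
  linarith

theorem le_dilogF_two_sq (hx : ‖x‖ ≤ 1) : 9 / 64 * x.re ^ 2 ≤ dilogF 2 x ^ 2 := by
  have h := le_dilogF_sq hx 2
  rw [re_sqrt_pow_two_sq, Nat.cast_ofNat] at h
  linarith

theorem norm_dilog_pow_le (hx : ‖x‖ ≤ 1) (hk : 2 ≤ k) : ‖dilog (x ^ k)‖ ≤ 5 / 3 * ‖x‖ ^ 2 := by
  have hpi : π ^ 2 ≤ 3.15 ^ 2 := pow_le_pow_left₀ Real.pi_nonneg Real.pi_lt_d2.le 2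
  calc ‖dilog (x ^ k)‖ ≤ π ^ 2 / 6 * ‖x ^ k‖ := norm_dilog_le (norm_pow_le_one hx k)
    _ = π ^ 2 / 6 * ‖x‖ ^ k := by rw [norm_pow]
    _ ≤ 5 / 3 * ‖x‖ ^ 2 := by
        gcongr ?_ * ?_
        · linarith
        · exact pow_le_pow_of_le_one (norm_nonneg x) hx hk

theorem dilogF_sq_le (hx : ‖x‖ ≤ 1) (hk : 2 ≤ k) :
    dilogF k x ^ 2 ≤ 5 / 3 * ‖x‖ ^ 2 / (k : ℝ) ^ 2 := by
  rw [dilogF_sq]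
  gcongr
  exact (re_sqrt_sq_le_norm _).trans (norm_dilog_pow_le hx hk)

theorem dilogF_sq_le_of_re_pow_nonpos (hx : ‖x‖ ≤ 1) (hk : 2 ≤ k) (hre : (x ^ k).re ≤ 0) :
    dilogF k x ^ 2 ≤ 5 / 6 * ‖x‖ ^ 2 / (k : ℝ) ^ 2 := by
  rw [dilogF_sq]
  gcongr
  linarith [re_sqrt_sq_le_half_norm (re_dilog_nonpos (norm_pow_le_one hx k) hre),
    norm_dilog_pow_le hx hk]

end NormalizedRoots

section Comparison

variable {x : ℂ} {k : ℕ}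

theorem dilogF_one_sq_le_max_sq (x : ℂ) :
    dilogF 1 x ^ 2 ≤ max (dilogF 1 x) (dilogF 2 x) ^ 2 :=
  pow_le_pow_left₀ (dilogF_nonneg 1 x) (le_max_left _ _) 2

theorem dilogF_two_sq_le_max_sq (x : ℂ) :
    dilogF 2 x ^ 2 ≤ max (dilogF 1 x) (dilogF 2 x) ^ 2 :=
  pow_le_pow_left₀ (dilogF_nonneg 2 x) (le_max_right _ _) 2

theorem le_max_dilogF_sq_of_neg_mul_norm_le_re {s : ℝ} (hx : ‖x‖ ≤ 1) (hs : s ≤ 1)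
    (hre : -(s * ‖x‖) ≤ x.re) :
    9 / 32 * (1 - s) * ‖x‖ ^ 2 ≤ max (dilogF 1 x) (dilogF 2 x) ^ 2 := by
  have := sub_nonneg.2 hs
  calc 9 / 32 * (1 - s) * ‖x‖ ^ 2 ≤ 9 / 32 * (1 - s) * ‖x‖ := by
        gcongr
        exact pow_le_of_le_one (norm_nonneg x) hx two_ne_zero
    _ ≤ 9 / 32 * (‖x‖ + x.re) := by linarith
    _ ≤ dilogF 1 x ^ 2 := le_dilogF_one_sq hx
    _ ≤ max (dilogF 1 x) (dilogF 2 x) ^ 2 := dilogF_one_sq_le_max_sq x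

theorem le_max_dilogF_sq_of_mul_norm_sq_le_re_sq {q : ℝ} (hx : ‖x‖ ≤ 1)
    (hre : q * ‖x‖ ^ 2 ≤ x.re ^ 2) :
    9 / 64 * q * ‖x‖ ^ 2 ≤ max (dilogF 1 x) (dilogF 2 x) ^ 2 := by
  linarith [le_dilogF_two_sq hx, dilogF_two_sq_le_max_sq x]

theorem sq_mul_norm_sq_le_re_sq {s : ℝ} (hs : 0 ≤ s) (hre : x.re ≤ -(s * ‖x‖)) :
    s ^ 2 * ‖x‖ ^ 2 ≤ x.re ^ 2 := by
  rw [← mul_pow, ← neg_sq x.re]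
  exact pow_le_pow_left₀ (by positivity) (by linarith) 2

theorem mul_norm_sq_le_max_dilogF_sq (hx : ‖x‖ ≤ 1) :
    9 / 128 * ‖x‖ ^ 2 ≤ max (dilogF 1 x) (dilogF 2 x) ^ 2 := by
  rcases le_total (-(3 / 4 * ‖x‖)) x.re with hre | hre
  · linarith [le_max_dilogF_sq_of_neg_mul_norm_le_re hx (by norm_num) hre]
  · have h := le_max_dilogF_sq_of_mul_norm_sq_le_re_sq hx
      (sq_mul_norm_sq_le_re_sq (by norm_num) hre)
    linarith [sq_nonneg ‖x‖]

theorem re_pow_four (z : ℂ) :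
    (z ^ 4).re = 8 * z.re ^ 4 - 8 * z.re ^ 2 * ‖z‖ ^ 2 + ‖z‖ ^ 4 := by
  have hnorm : ‖z‖ ^ 4 = (‖z‖ ^ 2) ^ 2 := by ring
  rw [hnorm, Complex.sq_norm, Complex.normSq_apply]
  simp only [pow_succ, pow_zero, one_mul, Complex.mul_re, Complex.mul_im]
  ring

theorem three_quarters_mul_norm_sq_le_re_sq (hre : x.re ≤ -(5 / 8 * ‖x‖))
    (hre4 : 0 ≤ (x ^ 4).re) : 3 / 4 * ‖x‖ ^ 2 ≤ x.re ^ 2 := by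
  have hlow := sq_mul_norm_sq_le_re_sq (by norm_num) hre
  rw [re_pow_four] at hre4
  by_contra! hhigh
  have hprod : 0 ≤ (x.re ^ 2 - (5 / 8) ^ 2 * ‖x‖ ^ 2) * (3 / 4 * ‖x‖ ^ 2 - x.re ^ 2) :=
    mul_nonneg (sub_nonneg.2 hlow) (sub_nonneg.2 hhigh.le)
  nlinarith [sq_nonneg x.re, sq_nonneg ‖x‖]

theorem mul_norm_sq_le_max_dilogF_sq_of_re_pow_four_nonneg (hx : ‖x‖ ≤ 1) (hre4 : 0 ≤ (x ^ 4).re) :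
    27 / 256 * ‖x‖ ^ 2 ≤ max (dilogF 1 x) (dilogF 2 x) ^ 2 := by
  rcases le_total (-(5 / 8 * ‖x‖)) x.re with hre | hre
  · linarith [le_max_dilogF_sq_of_neg_mul_norm_le_re hx (by norm_num) hre]
  · linarith [le_max_dilogF_sq_of_mul_norm_sq_le_re_sq hx
      (three_quarters_mul_norm_sq_le_re_sq hre hre4)]

theorem dilogF_four_sq_le_max_sq (hx : ‖x‖ ≤ 1) :
    dilogF 4 x ^ 2 ≤ max (dilogF 1 x) (dilogF 2 x) ^ 2 := by
  have hr := sq_nonneg ‖x‖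
  rcases le_total (x ^ 4).re 0 with hre | hre
  · have h := dilogF_sq_le_of_re_pow_nonpos hx (by norm_num) hre
    rw [Nat.cast_ofNat] at h
    linarith [mul_norm_sq_le_max_dilogF_sq hx]
  · have h := dilogF_sq_le hx (k := 4) (by norm_num)
    rw [Nat.cast_ofNat] at h
    linarith [mul_norm_sq_le_max_dilogF_sq_of_re_pow_four_nonneg hx hre]

theorem dilogF_sq_le_max_sq (hx : ‖x‖ ≤ 1) (hk : 5 ≤ k) :
    dilogF k x ^ 2 ≤ max (dilogF 1 x) (dilogF 2 x) ^ 2 := by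
  have hk' : (5 : ℝ) ≤ k := by exact_mod_cast hk
  calc dilogF k x ^ 2 ≤ 5 / 3 * ‖x‖ ^ 2 / (k : ℝ) ^ 2 := dilogF_sq_le hx (by lia)
    _ ≤ 5 / 3 * ‖x‖ ^ 2 / 5 ^ 2 := by gcongr
    _ ≤ 9 / 128 * ‖x‖ ^ 2 := by linarith [sq_nonneg ‖x‖]
    _ ≤ max (dilogF 1 x) (dilogF 2 x) ^ 2 := mul_norm_sq_le_max_dilogF_sq hx

theorem dilogF_le_max_one_two (hx : ‖x‖ ≤ 1) (hk : 4 ≤ k) :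
    dilogF k x ≤ max (dilogF 1 x) (dilogF 2 x) := by
  refine le_of_sq_le_sq ?_ (le_max_of_le_left (dilogF_nonneg 1 x))
  rcases hk.eq_or_lt with rfl | hk
  · exact dilogF_four_sq_le_max_sq hx
  · exact dilogF_sq_le_max_sq hx hk

end Comparison

theorem mainTheorem4 :
    (∀ x ∈ unitDisk, ∀ k : ℕ, 4 ≤ k →
      dilogF k x ≤ max (dilogF 1 x) (max (dilogF 2 x) (dilogF 3 x))) ∧
    (∀ x ∈ regionOne, ∀ k : ℕ, 2 ≤ k → dilogF k x ≤ dilogF 1 x) ∧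
    (∀ x ∈ regionTwo, ∀ k : ℕ, 3 ≤ k ∨ k = 1 → dilogF k x ≤ dilogF 2 x) ∧
    (∀ x ∈ regionThree, ∀ k : ℕ, 4 ≤ k ∨ k = 1 ∨ k = 2 → dilogF k x ≤ dilogF 3 x) := by
  have hmax {x : ℂ} (hx : x ∈ unitDisk) {k : ℕ} (hk : 4 ≤ k) :
      dilogF k x ≤ max (dilogF 1 x) (dilogF 2 x) :=
    dilogF_le_max_one_two (mem_closedBall_zero_iff.1 hx) hk
  refine ⟨fun x hx k hk => (hmax hx hk).trans (max_le_max_left _ (le_max_left _ _)), ?_, ?_, ?_⟩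
  · rintro x ⟨hx, h21, h31⟩ k hk
    obtain rfl | rfl | hk : k = 2 ∨ k = 3 ∨ 4 ≤ k := by lia
    exacts [h21, h31, (hmax hx hk).trans (max_le le_rfl h21)]
  · rintro x ⟨hx, h12, h32⟩ k hk
    obtain rfl | rfl | hk : k = 1 ∨ k = 3 ∨ 4 ≤ k := by lia
    exacts [h12, h32, (hmax hx hk).trans (max_le h12 le_rfl)]
  · rintro x ⟨hx, h13, h23⟩ k hk
    obtain rfl | rfl | hk : k = 1 ∨ k = 2 ∨ 4 ≤ k := by lia
    exacts [h13, h23, (hmax hx hk).trans (max_le h13 h23)]
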